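/- Let $p\equiv 1\pmod 4$ be a prime and write $p=c^2+d^2$ with $c,d\in\mathbb Z$ and $2\mid d$. Let $\left(\frac{\cdot}{\cdot}\right)$ denote the Legendre–Jacobi symbol; congruences modulo $p$ are between rational numbers whose denominators are not divisible by $p$. Let $b,m\in\mathbb Z$ with $\gcd(b,m)=1$ and $p\nmid m(b^2+4m^2)$. Then $$\left(\frac mp\right)\sum_{k=0}^{(p-1)/4}\binom{4k}{2k}\left(-\frac{b^2}{64m^2}\right)^k\equiv \begin{cases} \left(\dfrac{bc+2md}{b^2+4m^2}\right)\pmod p&\text{if }2\nmid b\text{ and }\left(\frac{b^2+4m^2}p\right)=1,\\[2mm] (-1)^{\frac{(\frac b2c+md)^2-1}8+\frac d2}\left(\dfrac{\frac b2c+md}{((\frac b2)^2+m^2)/2}\right)\pmod p&\text{if }2\mid b,\ 4\nmid b\text{ and }\left(\frac{b^2+4m^2}p\right)=1,\\[2mm] \left(\dfrac{mc-\frac b2d}{\frac{b^2}4+m^2}\right)\pmod p&\text{if }4\mid b\text{ and }\left(\frac{b^2+4m^2}p\right)=1,\\[2mm] 0\pmod p&\text{if }\left(\frac{b^2+4m^2}p\right)=-1,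 \end{cases}$$ and, if moreover $p\nmid b$, $$\left(\frac mp\right)\sum_{k=0}^{(p-1)/4}\binom{4k}{2k}\left(-\frac{b^2}{64m^2}\right)^k\equiv\left(\frac bp\right)\sum_{k=0}^{(p-1)/4}\binom{4k}{2k}\left(-\frac{m^2}{4b^2}\right)^k\pmod p.$$ In particular, for every $a\in\mathbb Z$ with $p\nmid 16a^2+1$, $$\sum_{k=0}^{(p-1)/4}\binom{4k}{2k}(-a^2)^k\equiv \begin{cases} \left(\dfrac{c-4ad}{16a^2+1}\right)\pmod p&\text{if }\left(\frac{16a^2+1}p\right)=1,\\[2mm] 0\pmod p&\text{if }\left(\frac{16a^2+1}p\right)=-1, \end{cases}$$ and, if moreover $p\nmid a$, $$\sum_{k=0}^{(p-1)/4}\binom{4k}{2k}(-a^2)^k\equiv\left(\frac{2a}p\right)\sum_{k=0}^{(p-1)/4}\binom{4k}{2k}\frac1{(-256a^2)^k}\pmod p.$$ -/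

import Mathlib

/-- The sum `∑_{k=0}^{(p-1)/4} C(4k,2k) x^k` modulo `p`. A congruence modulo `p` between rationals
with denominators prime to `p` is an equality in `ZMod p`. -/
def binomSum (p : ℕ) (x : ZMod p) : ZMod p :=
  ∑ k ∈ Finset.Icc 0 ((p - 1) / 4), (Nat.choose (4 * k) (2 * k) : ZMod p) * x ^ k

/-!
Put `n = (p - 1) / 2`. Modulo `p` one has `C(2j, j) ≡ C(n, j) (-4)^j`, so the binomial sum at `y²`
is the even part of `(1 + 4y)^n`, and Euler's criterion turns it into
`((1 + 4y | p) + (1 - 4y | p)) / 2`. The relation `c² + d² ≡ 0` makes `d / c` a square root of `-1`,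
and both sums become `((bc + 2md | p) + (bc - 2md | p)) / 2`, where the product of the two symbols
is `(b² + 4m² | p)`. To evaluate `(uc + vd | p)`, set `N = uc + vd`: since
`p (u² + v²) = N² + (ud - vc)²` is a square modulo `N`, quadratic reciprocity relates `(N | p)` to
the symbol of `N` over the odd part of `u² + v²`.
-/

open scoped NumberTheorySymbols

/-! ### The binomial sum as a sum of two Legendre symbols -/

section BinomSum

theorem sum_range_add_neg_one_pow_mul {R : Type*} [CommRing R] (f : ℕ → R) (m : ℕ) :
    ∑ j ∈ Finset.range m, (f j + (-1) ^ j * f j) =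
      2 * ∑ k ∈ Finset.range ((m + 1) / 2), f (2 * k) := by
  induction m with
  | zero => simp
  | succ m ih =>
    rw [Finset.sum_range_succ, ih]
    rcases Nat.even_or_odd' m with ⟨l, rfl | rfl⟩
    · rw [show (2 * l + 1) / 2 = l by omega, show (2 * l + 1 + 1) / 2 = l + 1 by omega,
        Finset.sum_range_succ, (even_two_mul l).neg_one_pow]
      ring
    · rw [show (2 * l + 1 + 1) / 2 = l + 1 by omega, show (2 * l + 1 + 1 + 1) / 2 = l + 1 by omega,
        (odd_two_mul_add_one l).neg_one_pow]
      ring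

theorem two_mul_sum_choose_two_mul {R : Type*} [CommRing R] (n : ℕ) (z : R) :
    2 * ∑ k ∈ Finset.range (n / 2 + 1), (n.choose (2 * k) : R) * z ^ (2 * k) =
      (1 + z) ^ n + (1 - z) ^ n := by
  rw [show n / 2 + 1 = (n + 1 + 1) / 2 by omega,
    ← sum_range_add_neg_one_pow_mul fun j => (n.choose j : R) * z ^ j,
    sub_eq_add_neg, add_comm 1 z, add_comm 1 (-z), add_pow, add_pow, ← Finset.sum_add_distrib]
  refine Finset.sum_congr rfl fun j _ => ?_
  rw [neg_pow z j]
  ring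

variable {p : ℕ} [Fact p.Prime]

theorem zmod_two_ne_zero (hp : p ≠ 2) : (2 : ZMod p) ≠ 0 :=
  ZMod.prime_ne_zero p 2 hp

theorem natCast_centralBinom_eq_choose_mul_pow (hp : p ≠ 2) {j : ℕ} (hj : j < p) :
    (j.centralBinom : ZMod p) = ((p / 2).choose j : ZMod p) * (-4) ^ j := by
  induction j with
  | zero => simp
  | succ j ih =>
    have hne : ((j : ZMod p) + 1) ≠ 0 := by
      rw [← Nat.cast_succ, Ne, ZMod.natCast_eq_zero_iff]
      exact fun h => absurd (Nat.le_of_dvd j.succ_pos h) (by omega)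
    have hhalf : (2 : ZMod p) * (p / 2 : ℕ) + 1 = 0 := by
      have := congrArg (Nat.cast (R := ZMod p))
        (Nat.two_mul_div_two_add_one_of_odd ((Fact.out : p.Prime).odd_of_ne_two hp))
      simpa using this
    have hcentral := congrArg (Nat.cast (R := ZMod p)) (Nat.succ_mul_centralBinom_succ j)
    have hchoose : ((p / 2).choose (j + 1) : ZMod p) * (j + 1) =
        (p / 2).choose j * ((p / 2 : ℕ) - j) := by
      rcases le_or_gt j (p / 2) with h | h
      · rw [← Nat.cast_sub h]
        exact_mod_cast congrArg (Nat.cast (R := ZMod p)) (Nat.choose_succ_right_eq (p / 2) j)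
      · simp [Nat.choose_eq_zero_of_lt h, Nat.choose_eq_zero_of_lt (h.trans j.lt_succ_self)]
    push_cast at hcentral
    apply mul_left_cancel₀ hne
    rw [hcentral, ih (by omega)]
    linear_combination (4 * (-4) ^ j) * hchoose + 2 * ((p / 2).choose j : ZMod p) * (-4) ^ j * hhalf

theorem two_mul_binomSum_sq (hp : p ≠ 2) (y : ZMod p) :
    2 * binomSum p (y ^ 2) = (1 + 4 * y) ^ (p / 2) + (1 - 4 * y) ^ (p / 2) := by
  have hodd := Nat.two_mul_div_two_add_one_of_odd ((Fact.out : p.Prime).odd_of_ne_two hp)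
  rw [← two_mul_sum_choose_two_mul, binomSum, ← Nat.range_succ_eq_Icc_zero,
    show (p - 1) / 4 = p / 2 / 2 by omega]
  congr 1
  refine Finset.sum_congr rfl fun k hk => ?_
  have hk : 2 * k < p := by rw [Finset.mem_range] at hk; omega
  have h := natCast_centralBinom_eq_choose_mul_pow hp hk
  rw [Nat.centralBinom, show 2 * (2 * k) = 4 * k by ring] at h
  rw [h, mul_pow, ← pow_mul, (even_two_mul k).neg_pow]
  ring

theorem two_mul_legendreSym_mul_binomSum_sq (hp : p ≠ 2) {r s : ℤ} (hs : (s : ZMod p) ≠ 0) :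
    2 * ((legendreSym p s : ZMod p) * binomSum p (((r : ZMod p) / (4 * s)) ^ 2)) =
      legendreSym p (s + r) + legendreSym p (s - r) := by
  have h4 : (4 : ZMod p) ≠ 0 := by
    rw [show (4 : ZMod p) = 2 ^ 2 by norm_num]
    exact pow_ne_zero 2 (zmod_two_ne_zero hp)
  have hy : 4 * ((r : ZMod p) / (4 * s)) = r / s := by field_simp
  simp only [legendreSym.eq_pow]
  rw [mul_left_comm, two_mul_binomSum_sq hp, hy, mul_add, ← mul_pow, ← mul_pow]
  push_cast
  congr 2 <;> field_simp

end BinomSum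

/-! ### Reciprocity for values of sums of two squares -/

theorem exists_prime_dvd_of_not_isCoprime {R : Type*} [CommRing R] [IsDomain R]
    [IsPrincipalIdealRing R] {x y : R} (hx : x ≠ 0) (h : ¬ IsCoprime x y) :
    ∃ q, Prime q ∧ q ∣ x ∧ q ∣ y := by
  contrapose! h
  exact isCoprime_of_prime_dvd (fun h0 => hx h0.1) h

theorem jacobiSym_eq_zero_of_prime_dvd {q a : ℤ} {n : ℕ} (hn : n ≠ 0) (hq : Prime q)
    (ha : q ∣ a) (hqn : q ∣ n) : J(a | n) = 0 :=
  jacobiSym.eq_zero_iff.2 ⟨hn, fun h =>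
    hq.not_isUnit ((Int.isCoprime_iff_gcd_eq_one.2 h).isUnit_of_dvd' ha hqn)⟩

theorem jacobiSym_eq_jacobiSym_natAbs {n : ℕ} (hn : n % 4 = 1) {N : ℤ} (hN : Odd N) :
    J(N | n) = J(n | N.natAbs) := by
  have h := jacobiSym.quadratic_reciprocity_one_mod_four' (Int.natAbs_odd.2 hN) hn
  rcases Int.natAbs_eq N with hpos | hneg
  · rwa [← hpos] at h
  · rw [← h, hneg, Int.natAbs_neg, Int.natAbs_natCast,
      jacobiSym.neg _ (Nat.odd_iff.2 (by omega)), ZMod.χ₄_nat_one_mod_four hn, one_mul]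

theorem jacobiSym_sq_add_sq_natAbs {N w : ℤ} (h : IsCoprime N w) :
    J(N ^ 2 + w ^ 2 | N.natAbs) = 1 := by
  have hgcd : w.gcd N.natAbs = 1 := by
    rw [← Int.isCoprime_iff_gcd_eq_one, Int.natCast_natAbs]
    exact h.symm.abs_right
  rw [← jacobiSym.sq_one' hgcd]
  refine jacobiSym.mod_left' (Int.ModEq.symm (Int.modEq_iff_dvd.2 ?_))
  rw [add_sub_cancel_right, Int.natAbs_dvd]
  exact dvd_pow_self N two_ne_zero

theorem jacobiSym_two_mul_eq_of_dvd_sq_add_sq {n : ℕ} (hn : Odd n) {x y : ℤ}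
    (h : (n : ℤ) ∣ x ^ 2 + y ^ 2) : J(2 * x | n) = J(y | n) := by
  have hn0 : n ≠ 0 := hn.pos.ne'
  by_cases hcop : IsCoprime (n : ℤ) (x + y)
  · apply Int.eq_of_mul_eq_one
    rw [← jacobiSym.mul_left, ← jacobiSym.sq_one' (Int.isCoprime_iff_gcd_eq_one.1 hcop.symm)]
    exact jacobiSym.mod_left' (Int.modEq_iff_dvd.2 (h.trans ⟨1, by ring⟩))
  · obtain ⟨q, hq, hqn, hqxy⟩ := exists_prime_dvd_of_not_isCoprime (by exact_mod_cast hn0) hcop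
    have hq2 : ¬ q ∣ 2 := fun h2 => hq.not_isUnit <|
      (Nat.isCoprime_iff_coprime.2 hn.coprime_two_right).isUnit_of_dvd' hqn h2
    have hqx : q ∣ x := by
      refine hq.dvd_of_dvd_pow (n := 2) ((hq.dvd_or_dvd ?_).resolve_left hq2)
      rw [show 2 * x ^ 2 = x ^ 2 + y ^ 2 + (x + y) * (x - y) by ring]
      exact dvd_add (hqn.trans h) (hqxy.mul_right _)
    rw [jacobiSym_eq_zero_of_prime_dvd hn0 hq (hqx.mul_left 2) hqn,
      jacobiSym_eq_zero_of_prime_dvd hn0 hq ((dvd_add_right hqx).1 hqxy) hqn]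

theorem jacobiSym_two_natAbs {N : ℤ} (hN : Odd N) :
    J(2 | N.natAbs) = (((-1 : ℤˣ) ^ ((N ^ 2 - 1) / 8) : ℤˣ) : ℤ) := by
  rw [jacobiSym.at_two (Int.natAbs_odd.2 hN), ZMod.χ₈_nat_eq_if_mod_eight]
  have hN2 : N % 2 = 1 := Int.odd_iff.1 hN
  obtain ⟨k, r, hk, hr⟩ : ∃ k r : ℤ, N = 8 * k + r ∧ (r = 1 ∨ r = 3 ∨ r = 5 ∨ r = 7) :=
    ⟨N / 8, N % 8, by omega, by omega⟩
  have hsq : (N ^ 2 - 1) / 8 = 2 * (4 * k ^ 2 + k * r) + (r ^ 2 - 1) / 8 := by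
    rw [show N ^ 2 - 1 = (r ^ 2 - 1) + 8 * (2 * (4 * k ^ 2 + k * r)) by rw [hk]; ring,
      Int.add_mul_ediv_left _ _ (by norm_num)]
    ring
  rw [hsq, zpow_add, (even_two_mul _).neg_one_zpow, one_mul, if_neg (by omega)]
  rcases hr with rfl | rfl | rfl | rfl
  · rw [if_pos (by omega)]; rfl
  · rw [if_neg (by omega)]; rfl
  · rw [if_neg (by omega)]; rfl
  · rw [if_pos (by omega)]; rfl

section SumTwoSquares

variable {n : ℕ} {c d : ℤ}

theorem mod_four_eq_one_of_eq_sq_add_sq (hn : (n : ℤ) = c ^ 2 + d ^ 2) (hc : Odd c)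
    (hd : Even d) : n % 4 = 1 := by
  have hc4 := Int.sq_mod_four_eq_one_of_odd hc
  obtain ⟨l, rfl⟩ := hd
  ring_nf at hn
  omega

theorem jacobiSym_left_eq_one_of_eq_sq_add_sq (hn : (n : ℤ) = c ^ 2 + d ^ 2) (hc : Odd c)
    (hd : Even d) (hcd : IsCoprime c d) : J(c | n) = 1 := by
  rw [jacobiSym_eq_jacobiSym_natAbs (mod_four_eq_one_of_eq_sq_add_sq hn hc hd) hc, hn,
    jacobiSym_sq_add_sq_natAbs hcd]

theorem jacobiSym_two_of_eq_sq_add_sq (hn : (n : ℤ) = c ^ 2 + d ^ 2) (hc : Odd c)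
    (hd : Even d) : J(2 | n) = (((-1 : ℤˣ) ^ (d / 2) : ℤˣ) : ℤ) := by
  obtain ⟨t, ht⟩ := Int.eight_dvd_sq_sub_one_of_odd hc
  obtain ⟨l, rfl⟩ := hd.two_dvd
  have hodd : Odd (n : ℤ) := ⟨4 * t + 2 * l ^ 2, by linear_combination hn + ht⟩
  obtain ⟨s, hs⟩ := (Int.even_mul_pred_self l).two_dvd
  have hexp : ((n : ℤ) ^ 2 - 1) / 8 =
      2 * (s + t * (1 + 4 * t + 2 * l ^ 2) + l ^ 2 * (2 * t + l ^ 2)) + l := by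
    refine Int.ediv_eq_of_eq_mul_right (by norm_num) ?_
    rw [hn]
    linear_combination ((2 * l) ^ 2 + c ^ 2 + 8 * t + 4 * l ^ 2 + 1) * ht + 8 * hs
  rw [← Int.natAbs_natCast n, jacobiSym_two_natAbs hodd, hexp, zpow_add,
    (even_two_mul _).neg_one_zpow, one_mul, Int.mul_ediv_cancel_left _ two_ne_zero]

theorem jacobiSym_eq_mul_jacobiSym_of_sq_add_sq (hn : (n : ℤ) = c ^ 2 + d ^ 2) (hc : Odd c)
    (hd : Even d) (hcd : IsCoprime c d) {u v r : ℤ} {k : ℕ} (hk : k % 4 = 1)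
    (hrk : r * k = u ^ 2 + v ^ 2) (hu : Odd u) (huv : IsCoprime u v) :
    J(u * c + v * d | n) = J(r | (u * c + v * d).natAbs) * J(u * c + v * d | k) := by
  have hn4 := mod_four_eq_one_of_eq_sq_add_sq hn hc hd
  have hn0 : n ≠ 0 := by omega
  have hk0 : k ≠ 0 := by omega
  have hodd : Odd (u * c + v * d) := (hu.mul hc).add_even (hd.mul_left v)
  have hN0 : u * c + v * d ≠ 0 := fun h => by simp [h] at hodd
  by_cases hcop : IsCoprime (u * c + v * d) (u * d - v * c)
  · have hsq := jacobiSym_sq_add_sq_natAbs hcop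
    rw [show (u * c + v * d) ^ 2 + (u * d - v * c) ^ 2 = n * (r * k) by rw [hn, hrk]; ring,
      jacobiSym.mul_left, jacobiSym.mul_left, ← jacobiSym_eq_jacobiSym_natAbs hn4 hodd,
      ← jacobiSym_eq_jacobiSym_natAbs hk hodd] at hsq
    exact Int.eq_of_mul_eq_one hsq
  · obtain ⟨q, hq, hqN, hqw⟩ := exists_prime_dvd_of_not_isCoprime hN0 hcop
    have hqn : q ∣ n := by
      obtain ⟨s, t, hst⟩ := huv
      rw [show (n : ℤ) = (u * c + v * d) * (s * c + t * d) + (u * d - v * c) * (s * d - t * c) by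
        linear_combination hn - (c ^ 2 + d ^ 2) * hst]
      exact dvd_add (hqN.mul_right _) (hqw.mul_right _)
    have hqrk : q ∣ r * k := by
      obtain ⟨s, t, hst⟩ := hcd
      rw [show r * k = (u * c + v * d) * (s * u + t * v) + (u * d - v * c) * (t * u - s * v) by
        linear_combination hrk - (u ^ 2 + v ^ 2) * hst]
      exact dvd_add (hqN.mul_right _) (hqw.mul_right _)
    rw [jacobiSym_eq_zero_of_prime_dvd hn0 hq hqN hqn]
    rcases hq.dvd_or_dvd hqrk with hqr | hqk
    · rw [jacobiSym_eq_zero_of_prime_dvd (Int.natAbs_ne_zero.2 hN0) hq hqr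
        (Int.dvd_natAbs.2 hqN), zero_mul]
    · rw [jacobiSym_eq_zero_of_prime_dvd hk0 hq hqN hqk, mul_zero]

theorem jacobiSym_eq_jacobiSym_sq_add_sq_of_odd_of_even (hn : (n : ℤ) = c ^ 2 + d ^ 2)
    (hc : Odd c) (hd : Even d) (hcd : IsCoprime c d) {u v : ℤ} (hu : Odd u) (hv : Even v)
    (huv : IsCoprime u v) :
    J(u * c + v * d | n) = J(u * c + v * d | (u ^ 2 + v ^ 2).natAbs) := by
  have habs : ((u ^ 2 + v ^ 2).natAbs : ℤ) = u ^ 2 + v ^ 2 := Int.natAbs_of_nonneg (by positivity)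
  rw [jacobiSym_eq_mul_jacobiSym_of_sq_add_sq hn hc hd hcd (r := 1)
    (mod_four_eq_one_of_eq_sq_add_sq habs hu hv) (by rw [habs, one_mul]) hu huv,
    jacobiSym.one_left, one_mul]

theorem jacobiSym_eq_jacobiSym_half_sq_add_sq_of_odd_of_odd (hn : (n : ℤ) = c ^ 2 + d ^ 2)
    (hc : Odd c) (hd : Even d) (hcd : IsCoprime c d) {u v : ℤ} (hu : Odd u) (hv : Odd v)
    (huv : IsCoprime u v) :
    J(u * c + v * d | n) =
      (((-1 : ℤˣ) ^ (((u * c + v * d) ^ 2 - 1) / 8) : ℤˣ) : ℤ) *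
        J(u * c + v * d | ((u ^ 2 + v ^ 2) / 2).natAbs) := by
  have hpos : 0 ≤ u ^ 2 + v ^ 2 := by positivity
  have hu8 := Int.eight_dvd_sq_sub_one_of_odd hu
  have hv8 := Int.eight_dvd_sq_sub_one_of_odd hv
  rw [jacobiSym_eq_mul_jacobiSym_of_sq_add_sq hn hc hd hcd (r := 2)
    (k := ((u ^ 2 + v ^ 2) / 2).natAbs) (by omega) (by omega) hu huv,
    jacobiSym_two_natAbs ((hu.mul hc).add_even (hd.mul_left v))]

end SumTwoSquares

/-! ### Evaluation of the binomial sum -/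

section Evaluation

variable {p : ℕ} [Fact p.Prime] {c d b m : ℤ}

theorem odd_left_of_eq_sq_add_sq (hp : p ≠ 2) (hpcd : (p : ℤ) = c ^ 2 + d ^ 2) (hd : Even d) :
    Odd c := by
  have hodd : Odd (c ^ 2 + d ^ 2) := by
    rw [← hpcd]
    exact_mod_cast (Fact.out : p.Prime).odd_of_ne_two hp
  rw [Int.odd_add] at hodd
  exact (Int.odd_pow' two_ne_zero).1 (hodd.2 (hd.pow_of_ne_zero two_ne_zero))

theorem isCoprime_of_prime_eq_sq_add_sq (hpcd : (p : ℤ) = c ^ 2 + d ^ 2) : IsCoprime c d := by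
  have hp : Prime (p : ℤ) := Nat.prime_iff_prime_int.1 Fact.out
  refine isCoprime_of_prime_dvd ?_ ?_
  · rintro ⟨rfl, rfl⟩
    exact hp.ne_zero (by simpa using hpcd)
  · rintro q hq ⟨x, rfl⟩ ⟨y, rfl⟩
    exact hq.not_isUnit (hp.irreducible.squarefree q ⟨x ^ 2 + y ^ 2, by rw [hpcd]; ring⟩)

theorem legendreSym_left_eq_one_of_eq_sq_add_sq (hp : p ≠ 2) (hpcd : (p : ℤ) = c ^ 2 + d ^ 2)
    (hd : Even d) : legendreSym p c = 1 := by
  rw [jacobiSym.legendreSym.to_jacobiSym]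
  exact jacobiSym_left_eq_one_of_eq_sq_add_sq hpcd (odd_left_of_eq_sq_add_sq hp hpcd hd) hd
    (isCoprime_of_prime_eq_sq_add_sq hpcd)

theorem legendreSym_two_mul_eq_of_dvd_sq_add_sq (hp : p ≠ 2) {x y : ℤ}
    (h : (p : ℤ) ∣ x ^ 2 + y ^ 2) : legendreSym p (2 * x) = legendreSym p y := by
  rw [jacobiSym.legendreSym.to_jacobiSym, jacobiSym.legendreSym.to_jacobiSym]
  exact jacobiSym_two_mul_eq_of_dvd_sq_add_sq ((Fact.out : p.Prime).odd_of_ne_two hp) h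

theorem intCast_sq_eq_neg_of_eq_sq_add_sq (hpcd : (p : ℤ) = c ^ 2 + d ^ 2) :
    (d : ZMod p) ^ 2 = -(c : ZMod p) ^ 2 := by
  have h := congrArg (Int.cast (R := ZMod p)) hpcd
  push_cast [ZMod.natCast_self] at h
  linear_combination -h

theorem intCast_ne_zero_of_legendreSym_eq_one {a : ℤ} (h : legendreSym p a = 1) :
    (a : ZMod p) ≠ 0 := fun h0 => by
  rw [(legendreSym.eq_zero_iff p a).2 h0] at h
  exact zero_ne_one h

theorem intCast_ne_zero_of_not_dvd {a : ℤ} (h : ¬ (p : ℤ) ∣ a) : (a : ZMod p) ≠ 0 :=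
  fun h0 => h ((ZMod.intCast_zmod_eq_zero_iff_dvd a p).1 h0)

theorem two_mul_legendreSym_mul_binomSum (hp : p ≠ 2) (hpcd : (p : ℤ) = c ^ 2 + d ^ 2)
    (hd : Even d) (hm : ¬ (p : ℤ) ∣ m) :
    2 * ((legendreSym p m : ZMod p) * binomSum p (-((b : ZMod p) ^ 2 / (64 * (m : ZMod p) ^ 2)))) =
      legendreSym p (b * c + 2 * m * d) + legendreSym p (b * c - 2 * m * d) := by
  have hc1 := legendreSym_left_eq_one_of_eq_sq_add_sq hp hpcd hd
  have hc0 := intCast_ne_zero_of_legendreSym_eq_one hc1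
  have hm0 := intCast_ne_zero_of_not_dvd hm
  have h2 : (2 : ZMod p) ≠ 0 := zmod_two_ne_zero hp
  have hs : ((2 ^ 2 * (m * c) : ℤ) : ZMod p) ≠ 0 := by
    simp only [Int.cast_mul, Int.cast_pow, Int.cast_ofNat]
    exact mul_ne_zero (pow_ne_zero 2 h2) (mul_ne_zero hm0 hc0)
  have harg : -((b : ZMod p) ^ 2 / (64 * (m : ZMod p) ^ 2)) =
      (((2 * (b * d) : ℤ) : ZMod p) / (4 * (2 ^ 2 * (m * c) : ℤ))) ^ 2 := by
    push_cast
    rw [div_pow, mul_pow 2, mul_pow (b : ZMod p), intCast_sq_eq_neg_of_eq_sq_add_sq hpcd,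
      show (64 : ZMod p) = 2 ^ 6 by norm_num, show (4 : ZMod p) = 2 ^ 2 by norm_num]
    field_simp
  have hplus : legendreSym p (2 * (2 * m * c + b * d)) = legendreSym p (b * c - 2 * m * d) :=
    legendreSym_two_mul_eq_of_dvd_sq_add_sq hp ⟨4 * m ^ 2 + b ^ 2, by rw [hpcd]; ring⟩
  have hminus : legendreSym p (2 * (2 * m * c - b * d)) = legendreSym p (b * c + 2 * m * d) :=
    legendreSym_two_mul_eq_of_dvd_sq_add_sq hp ⟨4 * m ^ 2 + b ^ 2, by rw [hpcd]; ring⟩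
  have hsum := two_mul_legendreSym_mul_binomSum_sq hp (r := 2 * (b * d)) hs
  rw [← harg, legendreSym.mul, legendreSym.sq_one' p (by exact_mod_cast h2), one_mul,
    legendreSym.mul, hc1, mul_one] at hsum
  rw [hsum, ← hplus, ← hminus, add_comm]
  ring_nf

theorem two_mul_legendreSym_mul_binomSum_swap (hp : p ≠ 2) (hpcd : (p : ℤ) = c ^ 2 + d ^ 2)
    (hd : Even d) (hb : ¬ (p : ℤ) ∣ b) :
    2 * ((legendreSym p b : ZMod p) * binomSum p (-((m : ZMod p) ^ 2 / (4 * (b : ZMod p) ^ 2)))) =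
      legendreSym p (b * c + 2 * m * d) + legendreSym p (b * c - 2 * m * d) := by
  have hc1 := legendreSym_left_eq_one_of_eq_sq_add_sq hp hpcd hd
  have hc0 := intCast_ne_zero_of_legendreSym_eq_one hc1
  have hb0 := intCast_ne_zero_of_not_dvd hb
  have hs : ((b * c : ℤ) : ZMod p) ≠ 0 := by
    push_cast
    exact mul_ne_zero hb0 hc0
  have harg : -((m : ZMod p) ^ 2 / (4 * (b : ZMod p) ^ 2)) =
      (((2 * m * d : ℤ) : ZMod p) / (4 * (b * c : ℤ))) ^ 2 := by
    have h2 : (2 : ZMod p) ≠ 0 := zmod_two_ne_zero hp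
    push_cast
    rw [div_pow, mul_pow (2 * m : ZMod p), intCast_sq_eq_neg_of_eq_sq_add_sq hpcd,
      show (4 : ZMod p) = 2 ^ 2 by norm_num]
    field_simp
  rw [← two_mul_legendreSym_mul_binomSum_sq hp hs, ← harg, legendreSym.mul, hc1, mul_one]

theorem legendreSym_mul_binomSum_eq_swap (hp : p ≠ 2) (hpcd : (p : ℤ) = c ^ 2 + d ^ 2)
    (hd : Even d) (hm : ¬ (p : ℤ) ∣ m) (hb : ¬ (p : ℤ) ∣ b) :
    (legendreSym p m : ZMod p) * binomSum p (-((b : ZMod p) ^ 2 / (64 * (m : ZMod p) ^ 2))) =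
      (legendreSym p b : ZMod p) *
        binomSum p (-((m : ZMod p) ^ 2 / (4 * (b : ZMod p) ^ 2))) := by
  apply mul_left_cancel₀ (zmod_two_ne_zero hp)
  rw [two_mul_legendreSym_mul_binomSum hp hpcd hd hm,
    two_mul_legendreSym_mul_binomSum_swap hp hpcd hd hb]

theorem legendreSym_mul_legendreSym_conj (hp : p ≠ 2) (hpcd : (p : ℤ) = c ^ 2 + d ^ 2)
    (hd : Even d) (b m : ℤ) :
    legendreSym p (b * c + 2 * m * d) * legendreSym p (b * c - 2 * m * d) =
      legendreSym p (b ^ 2 + 4 * m ^ 2) := by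
  have hc := intCast_ne_zero_of_legendreSym_eq_one
    (legendreSym_left_eq_one_of_eq_sq_add_sq hp hpcd hd)
  have hmod : legendreSym p ((b * c + 2 * m * d) * (b * c - 2 * m * d)) =
      legendreSym p (c ^ 2 * (b ^ 2 + 4 * m ^ 2)) := by
    rw [legendreSym.mod, legendreSym.mod p (c ^ 2 * _)]
    congr 1
    exact Int.modEq_iff_dvd.2 ⟨4 * m ^ 2, by rw [hpcd]; ring⟩
  rw [← legendreSym.mul, hmod, legendreSym.mul, legendreSym.sq_one' p hc, one_mul]

theorem legendreSym_mul_binomSum_of_legendreSym_eq_one (hp : p ≠ 2)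
    (hpcd : (p : ℤ) = c ^ 2 + d ^ 2) (hd : Even d) (hm : ¬ (p : ℤ) ∣ m)
    (h : legendreSym p (b ^ 2 + 4 * m ^ 2) = 1) :
    (legendreSym p m : ZMod p) * binomSum p (-((b : ZMod p) ^ 2 / (64 * (m : ZMod p) ^ 2))) =
      legendreSym p (b * c + 2 * m * d) := by
  rw [← legendreSym_mul_legendreSym_conj hp hpcd hd] at h
  apply mul_left_cancel₀ (zmod_two_ne_zero hp)
  rw [two_mul_legendreSym_mul_binomSum hp hpcd hd hm, ← Int.eq_of_mul_eq_one h]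
  exact (two_mul _).symm

theorem legendreSym_mul_binomSum_of_legendreSym_eq_neg_one (hp : p ≠ 2)
    (hpcd : (p : ℤ) = c ^ 2 + d ^ 2) (hd : Even d) (hm : ¬ (p : ℤ) ∣ m)
    (h : legendreSym p (b ^ 2 + 4 * m ^ 2) = -1) :
    (legendreSym p m : ZMod p) * binomSum p (-((b : ZMod p) ^ 2 / (64 * (m : ZMod p) ^ 2))) =
      0 := by
  rw [← legendreSym_mul_legendreSym_conj hp hpcd hd] at h
  apply mul_left_cancel₀ (zmod_two_ne_zero hp)
  rw [two_mul_legendreSym_mul_binomSum hp hpcd hd hm, mul_zero]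
  rcases Int.mul_eq_neg_one_iff_eq_one_or_neg_one.1 h with ⟨h₁, h₂⟩ | ⟨h₁, h₂⟩ <;>
    simp [h₁, h₂]

theorem odd_right_of_isCoprime_of_even (h : IsCoprime b m) (hb : Even b) : Odd m :=
  Int.isCoprime_two_left.1 (h.of_isCoprime_of_dvd_left hb.two_dvd)

theorem legendreSym_mul_binomSum_of_odd (hp : p ≠ 2) (hpcd : (p : ℤ) = c ^ 2 + d ^ 2)
    (hd : Even d) (hbm : IsCoprime b m) (hm : ¬ (p : ℤ) ∣ m) (hb : Odd b)
    (h : legendreSym p (b ^ 2 + 4 * m ^ 2) = 1) :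
    (legendreSym p m : ZMod p) * binomSum p (-((b : ZMod p) ^ 2 / (64 * (m : ZMod p) ^ 2))) =
      (J(b * c + 2 * m * d | (b ^ 2 + 4 * m ^ 2).natAbs) : ZMod p) := by
  have hb2m : IsCoprime b (2 * m) := (Int.isCoprime_two_right.2 hb).mul_right hbm
  rw [legendreSym_mul_binomSum_of_legendreSym_eq_one hp hpcd hd hm h,
    jacobiSym.legendreSym.to_jacobiSym,
    jacobiSym_eq_jacobiSym_sq_add_sq_of_odd_of_even hpcd (odd_left_of_eq_sq_add_sq hp hpcd hd) hd
      (isCoprime_of_prime_eq_sq_add_sq hpcd) hb (even_two_mul m) hb2m,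
    show (2 * m) ^ 2 = 4 * m ^ 2 by ring]

theorem legendreSym_mul_binomSum_of_even_of_not_four_dvd (hp : p ≠ 2)
    (hpcd : (p : ℤ) = c ^ 2 + d ^ 2) (hd : Even d) (hbm : IsCoprime b m) (hm : ¬ (p : ℤ) ∣ m)
    (hb : Even b) (hb4 : ¬ 4 ∣ b) (h : legendreSym p (b ^ 2 + 4 * m ^ 2) = 1) :
    (legendreSym p m : ZMod p) * binomSum p (-((b : ZMod p) ^ 2 / (64 * (m : ZMod p) ^ 2))) =
      (((((-1 : ℤˣ) ^ (((b / 2 * c + m * d) ^ 2 - 1) / 8 + d / 2) : ℤˣ) : ℤ) *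
        J(b / 2 * c + m * d | (((b / 2) ^ 2 + m ^ 2) / 2).natAbs) : ℤ) : ZMod p) := by
  have hc := odd_left_of_eq_sq_add_sq hp hpcd hd
  have hm2 := odd_right_of_isCoprime_of_even hbm hb
  obtain ⟨k, rfl⟩ := hb.two_dvd
  have hk : Odd k := by
    rw [← Int.not_even_iff_odd, even_iff_two_dvd]
    exact fun hk => hb4 (mul_dvd_mul_left 2 hk)
  rw [legendreSym_mul_binomSum_of_legendreSym_eq_one hp hpcd hd hm h,
    Int.mul_ediv_cancel_left _ two_ne_zero,
    show 2 * k * c + 2 * m * d = 2 * (k * c + m * d) by ring,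
    jacobiSym.legendreSym.to_jacobiSym, jacobiSym.mul_left,
    jacobiSym_two_of_eq_sq_add_sq hpcd hc hd,
    jacobiSym_eq_jacobiSym_half_sq_add_sq_of_odd_of_odd hpcd hc hd
      (isCoprime_of_prime_eq_sq_add_sq hpcd) hk hm2 hbm.of_mul_left_right,
    zpow_add, Units.val_mul, mul_left_comm, mul_assoc]

theorem legendreSym_mul_binomSum_of_four_dvd (hp : p ≠ 2) (hpcd : (p : ℤ) = c ^ 2 + d ^ 2)
    (hd : Even d) (hbm : IsCoprime b m) (hm : ¬ (p : ℤ) ∣ m) (hb : 4 ∣ b)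
    (h : legendreSym p (b ^ 2 + 4 * m ^ 2) = 1) :
    (legendreSym p m : ZMod p) * binomSum p (-((b : ZMod p) ^ 2 / (64 * (m : ZMod p) ^ 2))) =
      (J(m * c - b / 2 * d | (b ^ 2 / 4 + m ^ 2).natAbs) : ZMod p) := by
  obtain ⟨k, rfl⟩ := hb
  have hm2 : Odd m := odd_right_of_isCoprime_of_even hbm ⟨2 * k, by ring⟩
  have hmk : IsCoprime m (-(2 * k)) :=
    (hbm.of_isCoprime_of_dvd_left ⟨2, by ring⟩ : IsCoprime (2 * k) m).symm.neg_right
  have hhalf : 4 * k / 2 = 2 * k := by omega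
  have hsq : (4 * k) ^ 2 / 4 = (2 * k) ^ 2 := Int.ediv_eq_of_eq_mul_right (by norm_num) (by ring)
  have hswap : legendreSym p (2 * (2 * k * c + m * d)) = legendreSym p (m * c + -(2 * k) * d) :=
    legendreSym_two_mul_eq_of_dvd_sq_add_sq hp ⟨(2 * k) ^ 2 + m ^ 2, by rw [hpcd]; ring⟩
  rw [legendreSym_mul_binomSum_of_legendreSym_eq_one hp hpcd hd hm h,
    show 4 * k * c + 2 * m * d = 2 * (2 * k * c + m * d) by ring, hswap,
    jacobiSym.legendreSym.to_jacobiSym,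
    jacobiSym_eq_jacobiSym_sq_add_sq_of_odd_of_even hpcd (odd_left_of_eq_sq_add_sq hp hpcd hd) hd
      (isCoprime_of_prime_eq_sq_add_sq hpcd) hm2 (even_two_mul k).neg hmk,
    hhalf, hsq, neg_sq, add_comm (m ^ 2), neg_mul, ← sub_eq_add_neg]

theorem not_intCast_prime_dvd_one : ¬ (p : ℤ) ∣ 1 :=
  (Nat.prime_iff_prime_int.1 Fact.out).not_dvd_one

theorem binomSum_neg_sq (hp : p ≠ 2) (a : ℤ) :
    binomSum p (-(a : ZMod p) ^ 2) = (legendreSym p 1 : ZMod p) *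
      binomSum p (-(((8 * a : ℤ) : ZMod p) ^ 2 / (64 * ((1 : ℤ) : ZMod p) ^ 2))) := by
  have h64 : (64 : ZMod p) ≠ 0 := by
    rw [show (64 : ZMod p) = 2 ^ 6 by norm_num]
    exact pow_ne_zero 6 (zmod_two_ne_zero hp)
  rw [legendreSym.at_one, Int.cast_one, one_mul]
  congr 1
  push_cast
  field_simp
  ring

theorem legendreSym_two_sq_mul (hp : p ≠ 2) (a : ℤ) :
    legendreSym p (2 ^ 2 * a) = legendreSym p a := by
  have h2 : ((2 : ℤ) : ZMod p) ≠ 0 := by exact_mod_cast zmod_two_ne_zero hp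
  rw [legendreSym.mul, legendreSym.sq_one' p h2, one_mul]

theorem binomSum_neg_sq_eq_swap (hp : p ≠ 2) (hpcd : (p : ℤ) = c ^ 2 + d ^ 2) (hd : Even d)
    {a : ℤ} (ha : ¬ (p : ℤ) ∣ a) :
    binomSum p (-(a : ZMod p) ^ 2) =
      (legendreSym p (2 * a) : ZMod p) * binomSum p (1 / (-256 * (a : ZMod p) ^ 2)) := by
  have h8a : ¬ (p : ℤ) ∣ 8 * a := by
    rw [← ZMod.intCast_zmod_eq_zero_iff_dvd, show 8 * a = 2 ^ 3 * a by ring]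
    simp only [Int.cast_mul, Int.cast_pow, Int.cast_ofNat]
    exact mul_ne_zero (pow_ne_zero 3 (zmod_two_ne_zero hp)) (intCast_ne_zero_of_not_dvd ha)
  rw [binomSum_neg_sq hp, legendreSym_mul_binomSum_eq_swap hp hpcd hd not_intCast_prime_dvd_one h8a,
    show 8 * a = 2 ^ 2 * (2 * a) by ring, legendreSym_two_sq_mul hp]
  congr 2
  push_cast
  rw [neg_mul, div_neg, one_pow]
  ring

theorem legendreSym_eight_mul_sq_add (hp : p ≠ 2) (a : ℤ) :
    legendreSym p ((8 * a) ^ 2 + 4 * 1 ^ 2) = legendreSym p (16 * a ^ 2 + 1) := by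
  rw [← legendreSym_two_sq_mul hp (16 * a ^ 2 + 1)]
  ring_nf

theorem binomSum_neg_sq_of_legendreSym_eq_one (hp : p ≠ 2) (hpcd : (p : ℤ) = c ^ 2 + d ^ 2)
    (hd : Even d) {a : ℤ} (h : legendreSym p (16 * a ^ 2 + 1) = 1) :
    binomSum p (-(a : ZMod p) ^ 2) =
      (J(c - 4 * a * d | (16 * a ^ 2 + 1).natAbs) : ZMod p) := by
  have hhalf : 8 * a / 2 = 4 * a := by omega
  have hsq : (8 * a) ^ 2 / 4 = 16 * a ^ 2 :=
    Int.ediv_eq_of_eq_mul_right (by norm_num) (by ring)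
  rw [binomSum_neg_sq hp, legendreSym_mul_binomSum_of_four_dvd hp hpcd hd isCoprime_one_right
    not_intCast_prime_dvd_one ⟨2 * a, by ring⟩ ((legendreSym_eight_mul_sq_add hp a).trans h),
    hhalf, hsq, one_mul, one_pow]

theorem binomSum_neg_sq_of_legendreSym_eq_neg_one (hp : p ≠ 2)
    (hpcd : (p : ℤ) = c ^ 2 + d ^ 2) (hd : Even d) {a : ℤ}
    (h : legendreSym p (16 * a ^ 2 + 1) = -1) : binomSum p (-(a : ZMod p) ^ 2) = 0 := by
  rw [binomSum_neg_sq hp]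
  exact legendreSym_mul_binomSum_of_legendreSym_eq_neg_one hp hpcd hd not_intCast_prime_dvd_one
    ((legendreSym_eight_mul_sq_add hp a).trans h)

end Evaluation

theorem theorem2p10 (p : ℕ) [Fact p.Prime] (hp : p % 4 = 1) (c d : ℤ)
    (hcd : (p : ℤ) = c ^ 2 + d ^ 2) (hd : 2 ∣ d) :
    (∀ b m : ℤ, IsCoprime b m → ¬ (p : ℤ) ∣ m * (b ^ 2 + 4 * m ^ 2) →
      (¬ (p : ℤ) ∣ b →
        (legendreSym p m : ZMod p) * binomSum p (-((b : ZMod p) ^ 2 / (64 * (m : ZMod p) ^ 2))) =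
          (legendreSym p b : ZMod p) *
            binomSum p (-((m : ZMod p) ^ 2 / (4 * (b : ZMod p) ^ 2)))) ∧
      (¬ 2 ∣ b → legendreSym p (b ^ 2 + 4 * m ^ 2) = 1 →
        (legendreSym p m : ZMod p) * binomSum p (-((b : ZMod p) ^ 2 / (64 * (m : ZMod p) ^ 2))) =
          (jacobiSym (b * c + 2 * m * d) (b ^ 2 + 4 * m ^ 2).natAbs : ZMod p)) ∧
      (2 ∣ b → ¬ 4 ∣ b → legendreSym p (b ^ 2 + 4 * m ^ 2) = 1 →
        (legendreSym p m : ZMod p) * binomSum p (-((b : ZMod p) ^ 2 / (64 * (m : ZMod p) ^ 2))) =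
          (((((-1 : ℤˣ) ^ (((b / 2 * c + m * d) ^ 2 - 1) / 8 + d / 2) : ℤˣ) : ℤ) *
            jacobiSym (b / 2 * c + m * d) (((b / 2) ^ 2 + m ^ 2) / 2).natAbs : ℤ) : ZMod p)) ∧
      (4 ∣ b → legendreSym p (b ^ 2 + 4 * m ^ 2) = 1 →
        (legendreSym p m : ZMod p) * binomSum p (-((b : ZMod p) ^ 2 / (64 * (m : ZMod p) ^ 2))) =
          (jacobiSym (m * c - b / 2 * d) (b ^ 2 / 4 + m ^ 2).natAbs : ZMod p)) ∧
      (legendreSym p (b ^ 2 + 4 * m ^ 2) = -1 →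
        (legendreSym p m : ZMod p) * binomSum p (-((b : ZMod p) ^ 2 / (64 * (m : ZMod p) ^ 2))) =
          0)) ∧
    (∀ a : ℤ, ¬ (p : ℤ) ∣ 16 * a ^ 2 + 1 →
      (¬ (p : ℤ) ∣ a →
        binomSum p (-(a : ZMod p) ^ 2) =
          (legendreSym p (2 * a) : ZMod p) * binomSum p (1 / (-256 * (a : ZMod p) ^ 2))) ∧
      (legendreSym p (16 * a ^ 2 + 1) = 1 →
        binomSum p (-(a : ZMod p) ^ 2) =
          (jacobiSym (c - 4 * a * d) (16 * a ^ 2 + 1).natAbs : ZMod p)) ∧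
      (legendreSym p (16 * a ^ 2 + 1) = -1 → binomSum p (-(a : ZMod p) ^ 2) = 0)) := by
  have hp2 : p ≠ 2 := by omega
  have hd : Even d := even_iff_two_dvd.2 hd
  refine ⟨fun b m hbm hpm => ?_, fun a _ => ⟨binomSum_neg_sq_eq_swap hp2 hcd hd,
    binomSum_neg_sq_of_legendreSym_eq_one hp2 hcd hd,
    binomSum_neg_sq_of_legendreSym_eq_neg_one hp2 hcd hd⟩⟩
  have hm : ¬ (p : ℤ) ∣ m := fun h => hpm (h.mul_right _)
  refine ⟨legendreSym_mul_binomSum_eq_swap hp2 hcd hd hm, fun hb => ?_, fun hb => ?_,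
    legendreSym_mul_binomSum_of_four_dvd hp2 hcd hd hbm hm,
    legendreSym_mul_binomSum_of_legendreSym_eq_neg_one hp2 hcd hd hm⟩
  · have hb : Odd b := by rwa [← Int.not_even_iff_odd, even_iff_two_dvd]
    exact legendreSym_mul_binomSum_of_odd hp2 hcd hd hbm hm hb
  · exact legendreSym_mul_binomSum_of_even_of_not_four_dvd hp2 hcd hd hbm hm
      (even_iff_two_dvd.2 hb)
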